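/- **Setting.** Let $\mathcal A$ be a finite subset of a real normed space (for instance of $\mathbb R^d$ with any norm), $q\in\mathbb N$, $\mathcal I=\{0,1,\dots,q\}$, $\mathcal I_g=\{1,\dots,q\}$. Let $k$ be a positive semidefinite kernel on $\mathcal A\times\mathcal I$ and let $h:\mathcal A\times\mathcal I\to\mathbb R$ lie in the reproducing kernel Hilbert space of $k$, with $\|h\|_k\le B$. Write $f=h(\cdot,0)$ and $g_i=h(\cdot,i)$ for $i\in\mathcal I_g$, and let all these functions be Lipschitz with constant $L_a$. Let $S\subseteq\mathcal A$ be a nonempty safe seed: $g_i(a)\ge 0$ for all $a\in S$, $i\in\mathcal I_g$. Let $\sigma>0$, $\varepsilon>0$, $\delta>0$. *Observations.* In iteration $n\ge1$ a parameter $a_n\in\mathcal A$, chosen from the past without looking ahead, is evaluated, and $y_{n,i}=h(a_n,i)+\eta_{n,i}$ is observed for every $i\in\mathcal I$; the noise variables $\eta_{n,i}$ are $\sigma$-sub-Gaussian, independent of each other and of the past. Let $\mu_n(a,i)$ and $\sigma_n^2(a,i)$ be the posterior mean and variance at $(a,i)$ of a centred Gaussian process with covariance $k$ and observation noise variance $\sigma^2$,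 given the $n(q+1)$ observations of iterations $1,\dots,n$. *Information gain.* $\gamma_n=\max_{z_1,\dots,z_n\in\mathcal A\times\mathcal I}\tfrac12\log\det\bigl(I+\sigma^{-2}(k(z_s,z_t))_{s,t\le n}\bigr)$ is the maximal mutual information between $n$ (possibly repeated) values of the Gaussian process and their noisy observations. Put $$\beta_n^{1/2}=B+\max\{4\sigma,\sqrt2\}\,\sqrt{\gamma_{(n-1)|\mathcal I|}+1+\ln(1/\delta)}\qquad(n\ge 1),$$ where the square root of a negative number is read as $0$ (this can only occur for $\delta>1$). *Local safe exploration (LSE).* Let $S_0=S$, let $l_0(a,i)=0$ for $a\in S$, $i\in\mathcal I_g$ and $l_0(a,i)=-\infty$ otherwise, $u_0\equiv+\infty$, and for $n\ge1$ $$l_n=\max\{l_{n-1},\,\mu_{n-1}-\beta_n^{1/2}\sigma_{n-1}\},\qquad u_n=\min\{u_{n-1},\,\mu_{n-1}+\beta_n^{1/2}\sigma_{n-1}\},$$ $$S_n=\bigcap_{i\in\mathcal I_g}\bigcup_{a'\in S_{n-1}}\{a\in\mathcal A: l_n(a',i)-L_a\|a-a'\|\ge 0\}.$$ For $n\ge 0$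 let $w_n=u_n-l_n$, let $\mathcal G_n$ be the set of $a\in S_n$ such that $u_n(a,i)-L_a\|a-a'\|\ge0$ for some $a'\in\mathcal A\setminus S_n$ and some $i\in\mathcal I_g$ (expanders), and let $\mathcal M_n=\{a\in S_n:u_n(a,0)\ge\max_{a'\in S_n}l_n(a',0)\}$ (maximizers). For every $n\ge1$ the evaluated parameter $a_n$ maximizes $\max_{i\in\mathcal I}w_n(a,i)$ over $a\in\mathcal G_n\cup\mathcal M_n$ (ties broken in any way; $a_n$ is arbitrary if this set is empty). *Reachable region.* Let $R^c_\varepsilon(T)=T\cup\{a\in\mathcal A:\exists a'\in T\ \forall i\in\mathcal I_g:\ g_i(a')-\varepsilon-L_a\|a-a'\|\ge0\}$ and $\bar R^c_\varepsilon(S)=\lim_{n\to\infty}(R^c_\varepsilon)^n(S)=\bigcup_{n}(R^c_\varepsilon)^n(S)$. **Theorem.** Assume that $\gamma_n$ grows sublinearly, $\gamma_n/n\to0$. Let $n^*$ be the smallest integer $n\ge1$ such that $$\max_{a\in\mathcal G_{n-1}\cup\mathcal M_{n-1}}\ \max_{i\in\mathcal I}w_{n-1}(a,i)<\varepsilon\quad\text{and}\quad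 S_{n-1}=S_n$$ (the first condition counts as satisfied if $\mathcal G_{n-1}\cup\mathcal M_{n-1}=\emptyset$). Then $n^*$ is finite, and when running LSE, with probability at least $1-\delta$ the following holds for all $n\ge n^*$: $$\bar R^c_\varepsilon(S)\subseteq S_n\qquad\text{and}\qquad f(\hat a_n)\ \ge\ \max_{a\in\bar R^c_\varepsilon(S)}f(a)-\varepsilon$$ for every choice of $\hat a_n\in\operatorname{arg\,max}_{a\in S_n}l_n(a,0)$. -/

import Mathlib

open MeasureTheory ProbabilityTheory Filter
open scoped NNReal ENNReal Topology

noncomputable section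

namespace SafeExploration

/-! ### Gaussian process regression and information gain -/

section GP

variable {X ι : Type*} [Fintype ι] [DecidableEq ι]

/-- The scalar kernel `k(x, x')` of a reproducing kernel Hilbert space `H` of real functions on
`X`; Mathlib's kernel takes values in the linear maps `ℝ →L[ℝ] ℝ`. -/
def kern (H : Type*) {X : Type*} [NormedAddCommGroup H] [InnerProductSpace ℝ H] [CompleteSpace H]
    [RKHS ℝ H X ℝ] (x x' : X) : ℝ :=
  RKHS.kernel H x x' 1

/-- The covariance matrix of the sampled points `z`. -/
def gram (k : X → X → ℝ) (z : ι → X) : Matrix ι ι ℝ :=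
  Matrix.of fun s t => k (z s) (z t)

/-- Posterior mean at `x`, given the observations `y` at the points `z`, of a centred Gaussian
process with covariance `k` and observation noise of variance `σ ^ 2`. -/
def postMean (k : X → X → ℝ) (σ : ℝ) (z : ι → X) (y : ι → ℝ) (x : X) : ℝ :=
  (fun s => k x (z s)) ⬝ᵥ ((gram k z + σ ^ 2 • (1 : Matrix ι ι ℝ))⁻¹.mulVec y)

/-- Posterior variance at `x` of the same process. -/
def postVar (k : X → X → ℝ) (σ : ℝ) (z : ι → X) (x : X) : ℝ :=
  k x x - (fun s => k x (z s)) ⬝ᵥ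
    ((gram k z + σ ^ 2 • (1 : Matrix ι ι ℝ))⁻¹.mulVec fun s => k x (z s))

/-- The information gain of the points `z`: the mutual information between the values of the
Gaussian process at the points `z` and the noisy observations of these values,
`(1 / 2) log det (I + σ⁻² K)`. -/
def infoGain (k : X → X → ℝ) (σ : ℝ) (z : ι → X) : ℝ :=
  1 / 2 * Real.log (1 + (σ ^ 2)⁻¹ • gram k z).det

/-- The maximum information gain `γ_n` of `n` observations; a point may be observed repeatedly. -/
def maxInfoGain (k : X → X → ℝ) (σ : ℝ) (n : ℕ) : ℝ :=
  ⨆ z : Fin n → X, infoGain k σ z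

/-- The confidence scaling `β_n ^ (1/2)` of iteration `n ≥ 1`, when each of the previous `n - 1`
iterations has produced `m` observations. -/
def sqrtBeta (k : X → X → ℝ) (σ B δ : ℝ) (m n : ℕ) : ℝ :=
  B + max (4 * σ) √2 * √(maxInfoGain k σ ((n - 1) * m) + 1 + Real.log (1 / δ))

end GP

/-! ### Reachability -/

section Reach

variable {A : Type*} [PseudoMetricSpace A] {q : ℕ}

/-- The one-step reachability operator for the constraints `g i`, `i : Fin q`. -/
def reach (g : A → Fin q → ℝ) (L ε : ℝ) (S : Set A) : Set A :=
  S ∪ {a | ∃ a' ∈ S, ∀ i, 0 ≤ g a' i - ε - L * dist a a'}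

/-- The `ε`-reachable safe region: the limit (union) of the increasing iterates of `reach`. -/
def reachClosure (g : A → Fin q → ℝ) (L ε : ℝ) (S : Set A) : Set A :=
  ⋃ n : ℕ, (reach g L ε)^[n] S

end Reach

/-! ### Local safe exploration -/

/-- The data of one execution of safe exploration over the parameters `A`. The function indices
are `Fin (q + 1)`: index `0` is the objective and the indices `i.succ`, `i : Fin q`, are the
constraints. Iterations are numbered from `1`; entry `0` of `sqrtB`, `query`, `obs` is not used. -/
structure Run (A : Type*) (q : ℕ) where
  /-- kernel of the Gaussian process prior -/
  k : A × Fin (q + 1) → A × Fin (q + 1) → ℝ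
  /-- standard deviation of the noise in the Gaussian process model -/
  σ : ℝ
  /-- the scaling `β_n ^ (1/2)` of the confidence intervals -/
  sqrtB : ℕ → ℝ
  /-- Lipschitz constant -/
  L : ℝ
  /-- initial safe seed `S_0` -/
  seed : Set A
  /-- the parameter `a_n` evaluated in iteration `n` -/
  query : ℕ → A
  /-- the observation `obs n i` of function `i` in iteration `n` -/
  obs : ℕ → Fin (q + 1) → ℝ

namespace Run

variable {A : Type*} {q : ℕ}

/-- The points of `A × Fin (q + 1)` observed in the iterations `1, …, n`. -/
def points (r : Run A q) (n : ℕ) (s : Fin n × Fin (q + 1)) : A × Fin (q + 1) :=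
  (r.query (s.1 + 1), s.2)

/-- The posterior mean `μ_n(a, i)` after `n` iterations. -/
def mean (r : Run A q) (n : ℕ) (a : A) (i : Fin (q + 1)) : ℝ :=
  postMean r.k r.σ (r.points n) (fun s => r.obs (s.1 + 1) s.2) (a, i)

/-- The posterior standard deviation `σ_n(a, i)` after `n` iterations. -/
def sd (r : Run A q) (n : ℕ) (a : A) (i : Fin (q + 1)) : ℝ :=
  √(postVar r.k r.σ (r.points n) (a, i))

open scoped Classical in
/-- The lower confidence bound `l_n(a, i)`. -/
def lower (r : Run A q) : ℕ → A → Fin (q + 1) → EReal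
  | 0, a, i => if a ∈ r.seed ∧ i ≠ 0 then 0 else ⊥
  | n + 1, a, i =>
      max (r.lower n a i) ((r.mean n a i - r.sqrtB (n + 1) * r.sd n a i : ℝ) : EReal)

/-- The upper confidence bound `u_n(a, i)`. -/
def upper (r : Run A q) : ℕ → A → Fin (q + 1) → EReal
  | 0, _, _ => ⊤
  | n + 1, a, i =>
      min (r.upper n a i) ((r.mean n a i + r.sqrtB (n + 1) * r.sd n a i : ℝ) : EReal)

/-- The width `w_n(a, i)` of the confidence interval. -/
def width (r : Run A q) (n : ℕ) (a : A) (i : Fin (q + 1)) : EReal :=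
  r.upper n a i - r.lower n a i

variable [PseudoMetricSpace A]

/-- The safe set `S_n`. -/
def safeSet (r : Run A q) : ℕ → Set A
  | 0 => r.seed
  | n + 1 => ⋂ i : Fin q, ⋃ a' ∈ r.safeSet n,
      {a | 0 ≤ r.lower (n + 1) a' i.succ - ((r.L * dist a a' : ℝ) : EReal)}

/-- The expanders `G_n`. -/
def expanders (r : Run A q) (n : ℕ) : Set A :=
  {a ∈ r.safeSet n | ∃ a' ∉ r.safeSet n, ∃ i : Fin q,
    0 ≤ r.upper n a i.succ - ((r.L * dist a a' : ℝ) : EReal)}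

/-- The maximizers `M_n`. -/
def maximizers (r : Run A q) (n : ℕ) : Set A :=
  {a ∈ r.safeSet n | (⨆ a' ∈ r.safeSet n, r.lower n a' 0) ≤ r.upper n a 0}

/-- The evaluated parameters follow the acquisition rule of local safe exploration: in every
iteration `n ≥ 1`, `a_n` maximizes `max_i w_n(a, i)` over the expanders and the maximizers (there
is no restriction on `a_n` if there are none). -/
def IsLSE (r : Run A q) : Prop :=
  ∀ n, 1 ≤ n → (r.expanders n ∪ r.maximizers n).Nonempty →
    r.query n ∈ r.expanders n ∪ r.maximizers n ∧
      ∀ b ∈ r.expanders n ∪ r.maximizers n,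
        (⨆ i, r.width n b i) ≤ ⨆ i, r.width n (r.query n) i

/-- The stopping criterion in iteration `n ≥ 1`. -/
def Stops (r : Run A q) (ε : ℝ) (n : ℕ) : Prop :=
  1 ≤ n ∧
    (∀ a ∈ r.expanders (n - 1) ∪ r.maximizers (n - 1), ∀ i, r.width (n - 1) a i < (ε : EReal)) ∧
    r.safeSet (n - 1) = r.safeSet n

/-- The first iteration `n*` in which the stopping criterion holds (`⊤` if there is none). -/
def stopTime (r : Run A q) (ε : ℝ) : ℕ∞ :=
  ⨅ (n : ℕ) (_ : r.Stops ε n), (n : ℕ∞)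

/-- `a` is a possible choice of `argmax_{b ∈ S_n} l_n(b, 0)`. -/
def IsBest (r : Run A q) (n : ℕ) (a : A) : Prop :=
  a ∈ r.safeSet n ∧ ∀ b ∈ r.safeSet n, r.lower n b 0 ≤ r.lower n a 0

end Run

/-- The run of safe exploration on the function `h` with safe seed `S`, evaluated parameters `a`
and measurement noise `noise`: iteration `n` observes `h (a_n, i) + noise n i` for every `i`. -/
def mkRun {A : Type*} {q : ℕ} {H : Type*} [NormedAddCommGroup H] [InnerProductSpace ℝ H]
    [CompleteSpace H] [RKHS ℝ H (A × Fin (q + 1)) ℝ] (h : H) (σ B δ L : ℝ) (S : Set A)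
    (a : ℕ → A) (noise : ℕ → Fin (q + 1) → ℝ) : Run A q where
  k := kern H
  σ := σ
  sqrtB := sqrtBeta (kern H) σ B δ (q + 1)
  L := L
  seed := S
  query := a
  obs n i := h (a n, i) + noise n i

end SafeExploration

end

/-! The proof separates a probabilistic statement about the noise from a deterministic analysis of
each path.

Confidence. In feature space the posterior mean is a ridge estimator, and its error at a point
splits into a bias term, at most `‖h‖` times the posterior standard deviation, and a noise term.
Cauchy-Schwarz bounds the noise term by the same standard deviation times the root of `noiseEnergy /
σ ^ 2` (`abs_sub_postMean_le`). To control `noiseEnergy` for all `n` at once, the likelihood ratios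
of the noise are integrated against a Gaussian over weight vectors (method of mixtures). The mixture
is a nonnegative supermartingale, and it equals, up to the constant `gaussianMass`, the exponential
of `noiseEnergy / (2 σ ^ 2) - infoGain` (`lintegral_mixture`). Ville's inequality then gives
`measure_noiseEnergy_ge_le`, and the scaling `sqrtBeta` dominates the resulting radius
(`abs_sub_mean_le`).

Correctness. If all intervals are valid, then at a stop a reachable point outside the safe set would
make its witness an expander of width below `ε`, whose lower bound already certifies the point. The
best point of the safe set is a maximizer of width below `ε`, so its lower bound is `ε`-accurate and
the recommended point does at least as well (`subset_safeSet_and_le_of_isBest`).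

Termination holds on every path, whether or not the intervals are valid. The safe sets stabilize
because `A` is finite. By pigeonhole, infinitely often the evaluated point has been seen a number of
times linear in `n`, so its posterior variance is of order `1 / n`, while the squared scaling is
`o(n)`. Its width, the largest among all candidates, then falls below `ε` (`IsLSE.exists_stops`). -/

noncomputable section

namespace SafeExploration

/-! ### Gaussian process regression in feature space -/

section Regression

open Matrix

variable {X ι F : Type*} [Fintype ι] [DecidableEq ι] [NormedAddCommGroup F] [InnerProductSpace ℝ F]
  {k : X → X → ℝ} {φ : X → F} {σ : ℝ}

/-- The combination of the features of the points `z` with coefficients `u`. -/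
def featureSum (φ : X → F) (z : ι → X) (u : ι → ℝ) : F := ∑ s, u s • φ (z s)

/-- The regularized covariance matrix of the points `z`. -/
def regGram (k : X → X → ℝ) (σ : ℝ) (z : ι → X) : Matrix ι ι ℝ :=
  gram k z + σ ^ 2 • (1 : Matrix ι ι ℝ)

/-- The coefficients of the observations in the posterior mean at `x`. -/
def postWeight (k : X → X → ℝ) (σ : ℝ) (z : ι → X) (x : X) : ι → ℝ :=
  (regGram k σ z)⁻¹ *ᵥ fun s => k x (z s)

omit [DecidableEq ι] in
theorem inner_featureSum (hk : ∀ x y, k x y = inner ℝ (φ x) (φ y)) (z : ι → X) (u : ι → ℝ) (x : X) :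
    inner ℝ (φ x) (featureSum φ z u) = (fun s => k x (z s)) ⬝ᵥ u := by
  simp [featureSum, inner_sum, inner_smul_right, dotProduct, hk, mul_comm]

omit [DecidableEq ι] in
theorem inner_featureSum_featureSum (hk : ∀ x y, k x y = inner ℝ (φ x) (φ y)) (z : ι → X)
    (u v : ι → ℝ) :
    inner ℝ (featureSum φ z u) (featureSum φ z v) = u ⬝ᵥ gram k z *ᵥ v := by
  conv_lhs => rw [featureSum, sum_inner]
  simp_rw [inner_smul_left, inner_featureSum hk]
  rfl

omit [Fintype ι] [DecidableEq ι] in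
theorem gram_symm (hk : ∀ x y, k x y = inner ℝ (φ x) (φ y)) (z : ι → X) : (gram k z)ᵀ = gram k z := by
  ext i j
  simp [gram, hk, real_inner_comm]

omit [DecidableEq ι] in
theorem gram_posSemidef (hk : ∀ x y, k x y = inner ℝ (φ x) (φ y)) (z : ι → X) :
    (gram k z).PosSemidef := by
  refine Matrix.PosSemidef.of_dotProduct_mulVec_nonneg ?_ fun u => ?_
  · rw [Matrix.IsHermitian, conjTranspose_eq_transpose_of_trivial, gram_symm hk]
  · rw [star_trivial, ← inner_featureSum_featureSum hk]
    exact real_inner_self_nonneg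

theorem regGram_posDef (hk : ∀ x y, k x y = inner ℝ (φ x) (φ y)) (hσ : σ ≠ 0) (z : ι → X) :
    (regGram k σ z).PosDef :=
  Matrix.PosDef.posSemidef_add (gram_posSemidef hk z)
    (Matrix.PosDef.one.smul (by positivity))

theorem regGram_mulVec_inv (hk : ∀ x y, k x y = inner ℝ (φ x) (φ y)) (hσ : σ ≠ 0) (z : ι → X)
    (v : ι → ℝ) : regGram k σ z *ᵥ ((regGram k σ z)⁻¹ *ᵥ v) = v := by
  rw [mulVec_mulVec, mul_nonsing_inv _ ((isUnit_iff_isUnit_det _).1 (regGram_posDef hk hσ z).isUnit),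
    one_mulVec]

theorem regGram_mulVec (z : ι → X) (u : ι → ℝ) :
    regGram k σ z *ᵥ u = gram k z *ᵥ u + σ ^ 2 • u := by
  rw [regGram, add_mulVec, smul_mulVec, one_mulVec]

theorem regGram_dotProduct_comm (hk : ∀ x y, k x y = inner ℝ (φ x) (φ y)) (z : ι → X) (u v : ι → ℝ) :
    u ⬝ᵥ regGram k σ z *ᵥ v = (regGram k σ z *ᵥ u) ⬝ᵥ v := by
  rw [dotProduct_mulVec, ← mulVec_transpose, regGram, transpose_add, gram_symm hk, transpose_smul,
    transpose_one]

theorem postMean_eq (hk : ∀ x y, k x y = inner ℝ (φ x) (φ y)) (hσ : σ ≠ 0) (z : ι → X) (y : ι → ℝ)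
    (x : X) : postMean k σ z y x = postWeight k σ z x ⬝ᵥ y := by
  conv_rhs => rw [← regGram_mulVec_inv hk hσ z y, regGram_dotProduct_comm hk, postWeight,
    regGram_mulVec_inv hk hσ]
  rfl

/-- The regularized squared approximation error of the feature of `x`. -/
theorem norm_sub_featureSum_sq (hk : ∀ x y, k x y = inner ℝ (φ x) (φ y)) (z : ι → X) (u : ι → ℝ)
    (x : X) : ‖φ x - featureSum φ z u‖ ^ 2 + σ ^ 2 * (u ⬝ᵥ u) =
      k x x - 2 * ((fun s => k x (z s)) ⬝ᵥ u) + u ⬝ᵥ regGram k σ z *ᵥ u := by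
  rw [norm_sub_sq_real, inner_featureSum hk, ← real_inner_self_eq_norm_sq,
    ← real_inner_self_eq_norm_sq, inner_featureSum_featureSum hk, regGram_mulVec, dotProduct_add,
    dotProduct_smul, ← hk, smul_eq_mul]
  ring

/-- The posterior weights solve the normal equations of ridge regression of `φ x` on the observed
features. The variance is the optimal value, split into residual and penalty. -/
theorem postVar_eq (hk : ∀ x y, k x y = inner ℝ (φ x) (φ y)) (hσ : σ ≠ 0) (z : ι → X) (x : X) :
    postVar k σ z x = ‖φ x - featureSum φ z (postWeight k σ z x)‖ ^ 2 +
      σ ^ 2 * (postWeight k σ z x ⬝ᵥ postWeight k σ z x) := by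
  rw [norm_sub_featureSum_sq hk]
  conv_rhs => enter [2, 2]; rw [postWeight, regGram_mulVec_inv hk hσ]
  rw [dotProduct_comm (postWeight k σ z x)]
  simp only [postVar, postWeight, regGram]
  ring

/-- The gap between the two sides is the positive form `regGram` at `u - postWeight`, so any trial
coefficients bound the variance. -/
theorem postVar_le (hk : ∀ x y, k x y = inner ℝ (φ x) (φ y)) (hσ : σ ≠ 0) (z : ι → X) (x : X)
    (u : ι → ℝ) :
    postVar k σ z x ≤ ‖φ x - featureSum φ z u‖ ^ 2 + σ ^ 2 * (u ⬝ᵥ u) := by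
  have h0 := (regGram_posDef hk hσ z).posSemidef.dotProduct_mulVec_nonneg (u - postWeight k σ z x)
  rw [star_trivial, mulVec_sub, dotProduct_sub, sub_dotProduct, sub_dotProduct,
    regGram_dotProduct_comm hk z (postWeight k σ z x) u] at h0
  have h1 : regGram k σ z *ᵥ postWeight k σ z x = fun s => k x (z s) := regGram_mulVec_inv hk hσ z _
  have h2 : postVar k σ z x = k x x - (fun s => k x (z s)) ⬝ᵥ postWeight k σ z x := rfl
  rw [h1, dotProduct_comm u (fun s => k x (z s)),
    dotProduct_comm (postWeight k σ z x) (fun s => k x (z s))] at h0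
  rw [norm_sub_featureSum_sq hk, h2]
  linarith

/-- Repeated observations of a point reduce its posterior variance. -/
theorem postVar_le_div_card (hk : ∀ x y, k x y = inner ℝ (φ x) (φ y)) (hσ : σ ≠ 0) (z : ι → X)
    (x : X) (T : Finset ι) (hT : ∀ s ∈ T, z s = x) (hne : T.Nonempty) :
    postVar k σ z x ≤ σ ^ 2 / T.card := by
  have hc : (T.card : ℝ) ≠ 0 := by exact_mod_cast hne.card_pos.ne'
  -- Averaging over the repetitions reproduces `φ x` exactly, so only the penalty `σ ^ 2 * |T| *
  -- |T|⁻²` remains.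
  refine (postVar_le hk hσ z x fun s => if s ∈ T then (T.card : ℝ)⁻¹ else 0).trans_eq ?_
  have h1 : featureSum φ z (fun s => if s ∈ T then (T.card : ℝ)⁻¹ else 0) = φ x := by
    simp only [featureSum, ite_smul, zero_smul, Finset.sum_ite_mem, Finset.univ_inter]
    rw [Finset.sum_congr rfl fun s hs => by rw [hT s hs], Finset.sum_const, ← Nat.cast_smul_eq_nsmul ℝ,
      smul_smul, mul_inv_cancel₀ hc, one_smul]
  rw [h1]
  simp only [dotProduct, mul_ite, mul_zero, ite_mul, zero_mul, Finset.sum_ite_mem, Finset.univ_inter]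
  simp only [Finset.inter_self, Finset.sum_const, nsmul_eq_mul, sub_self,
    norm_zero]
  field_simp
  simp

/-- The squared norm, in the metric of the posterior, of the noise `η` at the points `z`. -/
def noiseEnergy (k : X → X → ℝ) (σ : ℝ) (z : ι → X) (η : ι → ℝ) : ℝ :=
  η ⬝ᵥ gram k z *ᵥ ((regGram k σ z)⁻¹ *ᵥ η)

theorem noiseEnergy_eq (hk : ∀ x y, k x y = inner ℝ (φ x) (φ y)) (hσ : σ ≠ 0) (z : ι → X)
    (η : ι → ℝ) : noiseEnergy k σ z η =
      (gram k z *ᵥ ((regGram k σ z)⁻¹ *ᵥ η)) ⬝ᵥ (gram k z *ᵥ ((regGram k σ z)⁻¹ *ᵥ η)) +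
        σ ^ 2 * ‖featureSum φ z ((regGram k σ z)⁻¹ *ᵥ η)‖ ^ 2 := by
  rw [← real_inner_self_eq_norm_sq, inner_featureSum_featureSum hk]
  conv_lhs => rw [noiseEnergy]; enter [1]; rw [← regGram_mulVec_inv hk hσ z η, regGram_mulVec]
  rw [add_dotProduct, smul_dotProduct, smul_eq_mul]

theorem add_sqrt_cauchy {a b c d : ℝ} : a * b + c * d ≤ √(a ^ 2 + c ^ 2) * √(b ^ 2 + d ^ 2) := by
  rw [← Real.sqrt_mul (by positivity)]
  exact Real.le_sqrt_of_sq_le (by nlinarith [sq_nonneg (a * d - b * c)])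

omit [DecidableEq ι] in
theorem dotProduct_le_sqrt (u v : ι → ℝ) : u ⬝ᵥ v ≤ √(u ⬝ᵥ u) * √(v ⬝ᵥ v) := by
  simpa [dotProduct, sq] using Real.sum_mul_le_sqrt_mul_sqrt Finset.univ u v

/-- The error that the noise causes in the posterior mean. -/
theorem postWeight_dotProduct_le (hk : ∀ x y, k x y = inner ℝ (φ x) (φ y)) (hσ : 0 < σ) (z : ι → X)
    (η : ι → ℝ) (x : X) : postWeight k σ z x ⬝ᵥ η ≤
      √(postVar k σ z x) * √(noiseEnergy k σ z η / σ ^ 2) := by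
  set u := (regGram k σ z)⁻¹ *ᵥ η with hu
  set α := postWeight k σ z x with hα
  have hdd : ∀ w : ι → ℝ, 0 ≤ w ⬝ᵥ w := fun w => by
    simpa using dotProduct_star_self_nonneg w
  -- This splitting matches the two summands of `postVar_eq` with those of `noiseEnergy_eq`, so one
  -- Cauchy-Schwarz inequality handles both.
  have h1 : α ⬝ᵥ η = inner ℝ (φ x - featureSum φ z α) (featureSum φ z u) + α ⬝ᵥ gram k z *ᵥ u := by
    rw [inner_sub_left, inner_featureSum hk, inner_featureSum_featureSum hk, sub_add_cancel]
    exact (postMean_eq hk hσ.ne' z η x).symm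
  have h2 := real_inner_le_norm (φ x - featureSum φ z α) (featureSum φ z u)
  have h3 := dotProduct_le_sqrt α (gram k z *ᵥ u)
  rw [h1]
  calc _ ≤ ‖φ x - featureSum φ z α‖ * ‖featureSum φ z u‖ +
        (σ * √(α ⬝ᵥ α)) * (√((gram k z *ᵥ u) ⬝ᵥ (gram k z *ᵥ u)) / σ) := by
        refine add_le_add h2 (h3.trans_eq ?_)
        field_simp
    _ ≤ _ := add_sqrt_cauchy
    _ = _ := by
      rw [postVar_eq hk hσ.ne', noiseEnergy_eq hk hσ.ne', mul_pow, Real.sq_sqrt (hdd _), div_pow,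
        Real.sq_sqrt (hdd _)]
      congr 2
      field_simp
      ring

/-- The confidence interval of kernel regression. -/
theorem abs_sub_postMean_le (hk : ∀ x y, k x y = inner ℝ (φ x) (φ y)) (hσ : 0 < σ) (z : ι → X)
    (η : ι → ℝ) (f : F) (x : X) :
    |inner ℝ (φ x) f - postMean k σ z (fun s => inner ℝ (φ (z s)) f + η s) x| ≤
      (‖f‖ + √(noiseEnergy k σ z η / σ ^ 2)) * √(postVar k σ z x) := by
  set α := postWeight k σ z x with hα
  have h1 : inner ℝ (φ x) f - postMean k σ z (fun s => inner ℝ (φ (z s)) f + η s) x =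
      inner ℝ (φ x - featureSum φ z α) f - α ⬝ᵥ η := by
    rw [postMean_eq hk hσ.ne', inner_sub_left]
    have : (fun s => inner ℝ (φ (z s)) f + η s) = (fun s => inner ℝ (φ (z s)) f) + η := rfl
    rw [this, dotProduct_add, featureSum, sum_inner]
    simp_rw [inner_smul_left]
    simp only [dotProduct, conj_trivial]
    ring
  have h2 : |inner ℝ (φ x - featureSum φ z α) f| ≤ √(postVar k σ z x) * ‖f‖ := by
    refine (abs_real_inner_le_norm _ _).trans (mul_le_mul_of_nonneg_right ?_ (norm_nonneg _))
    refine Real.le_sqrt_of_sq_le ?_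
    rw [postVar_eq hk hσ.ne']
    have : 0 ≤ α ⬝ᵥ α := by simpa using dotProduct_star_self_nonneg α
    rw [← hα]
    nlinarith [sq_nonneg σ]
  have h3 : |α ⬝ᵥ η| ≤ √(postVar k σ z x) * √(noiseEnergy k σ z η / σ ^ 2) := by
    refine abs_le'.2 ⟨postWeight_dotProduct_le hk hσ z η x, ?_⟩
    have := postWeight_dotProduct_le hk hσ z (-η) x
    rwa [noiseEnergy, mulVec_neg, mulVec_neg, neg_dotProduct_neg, dotProduct_neg] at this
  rw [h1]
  refine (abs_sub _ _).trans ?_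
  linarith

end Regression

/-! ### Gaussian mixtures -/

section Gaussian

open Matrix

variable {J : Type*} [Fintype J]

/-- The total mass of the unnormalized standard Gaussian density on `J → ℝ`. -/
def gaussianMass (J : Type*) [Fintype J] : ℝ≥0∞ :=
  ∫⁻ w : J → ℝ, ENNReal.ofReal (Real.exp (-(w ⬝ᵥ w) / 2))

theorem gaussianMass_ne_top : gaussianMass J ≠ ∞ := by
  have h : Integrable fun w : J → ℝ => ∏ j, Real.exp (-(1 / 2) * w j ^ 2) :=
    Integrable.fintype_prod fun _ => integrable_exp_neg_mul_sq (by norm_num)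
  have h2 := h.lintegral_lt_top.ne
  refine ne_of_eq_of_ne (lintegral_congr fun w => ?_) h2
  rw [← Real.exp_sum, dotProduct, ← Finset.mul_sum]
  simp_rw [sq]
  ring_nf

theorem gaussianMass_ne_zero : gaussianMass J ≠ 0 := by
  rw [gaussianMass, ← pos_iff_ne_zero, lintegral_pos_iff_support]
  · have : (Function.support fun w : J → ℝ => ENNReal.ofReal (Real.exp (-(w ⬝ᵥ w) / 2))) =
        Set.univ := by
      ext w
      simp [Real.exp_pos]
    rw [this]
    exact isOpen_univ.measure_pos volume Set.univ_nonempty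
  · simp only [dotProduct]
    fun_prop

open scoped MatrixOrder Matrix.Norms.L2Operator in
theorem exists_eq_transpose_mul_self [DecidableEq J] {P : Matrix J J ℝ} (hP : P.PosSemidef) :
    ∃ R : Matrix J J ℝ, P = Rᵀ * R := by
  obtain ⟨R, hR⟩ := CStarAlgebra.nonneg_iff_eq_star_mul_self.1 hP.nonneg
  exact ⟨R, hR⟩

/-- Linear change of variables `w ↦ R w`, where `P = Rᵀ * R`. -/
theorem lintegral_exp_neg_quadratic [DecidableEq J] {P : Matrix J J ℝ} (hP : P.PosDef) :
    ∫⁻ w : J → ℝ, ENNReal.ofReal (Real.exp (-(w ⬝ᵥ P *ᵥ w) / 2)) =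
      ENNReal.ofReal (√P.det)⁻¹ * gaussianMass J := by
  obtain ⟨R, rfl⟩ := exists_eq_transpose_mul_self hP.posSemidef
  have hdet : R.det ≠ 0 := by
    have := hP.det_pos
    rw [det_mul, det_transpose] at this
    rintro h
    simp [h] at this
  have hm : Measurable fun w : J → ℝ => ENNReal.ofReal (Real.exp (-(w ⬝ᵥ w) / 2)) := by
    simp only [dotProduct]
    fun_prop
  have h1 := lintegral_map (μ := volume) hm
    (LinearMap.continuous_of_finiteDimensional (toLin' R)).measurable
  rw [Real.map_matrix_volume_pi_eq_smul_volume_pi hdet, lintegral_smul_measure] at h1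
  rw [det_mul, det_transpose, Real.sqrt_mul_self_eq_abs, ← abs_inv]
  refine Eq.trans ?_ h1.symm
  refine lintegral_congr fun w => ?_
  rw [toLin'_apply, ← mulVec_mulVec, dotProduct_mulVec, vecMul_transpose]

/-- Completing the square: translating `w` by `x` removes the linear term. -/
theorem lintegral_exp_quadratic [DecidableEq J] {P : Matrix J J ℝ} (hP : P.PosDef) (x : J → ℝ) :
    ∫⁻ w : J → ℝ, ENNReal.ofReal (Real.exp ((P *ᵥ x) ⬝ᵥ w - (w ⬝ᵥ P *ᵥ w) / 2)) =
      ENNReal.ofReal ((√P.det)⁻¹ * Real.exp ((x ⬝ᵥ P *ᵥ x) / 2)) * gaussianMass J := by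
  have hsymm : ∀ u v : J → ℝ, u ⬝ᵥ P *ᵥ v = (P *ᵥ u) ⬝ᵥ v := fun u v => by
    have := hP.isHermitian
    rw [IsHermitian, conjTranspose_eq_transpose_of_trivial] at this
    rw [dotProduct_mulVec, ← mulVec_transpose, this]
  rw [ENNReal.ofReal_mul (by positivity), mul_right_comm, ← lintegral_exp_neg_quadratic hP,
    ← lintegral_add_right_eq_self _ x, ← lintegral_mul_const' _ _ ENNReal.ofReal_ne_top]
  refine lintegral_congr fun w => ?_
  rw [← ENNReal.ofReal_mul (Real.exp_pos _).le, ← Real.exp_add]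
  congr 2
  simp only [mulVec_add, dotProduct_add, add_dotProduct]
  rw [← hsymm x w, ← hsymm x x, hsymm w x, dotProduct_comm (P *ᵥ w) x]
  ring

variable {X ι : Type*} [Fintype ι] [DecidableEq ι]

/-- The logarithm of the likelihood ratio of the observation noise `y` at a point with features `c`
when the weight vector `w` is compared with `0`. -/
def logLik (σ : ℝ) (c w : J → ℝ) (y : ℝ) : ℝ :=
  (c ⬝ᵥ w) * y / σ ^ 2 - (c ⬝ᵥ w) ^ 2 / (2 * σ ^ 2)

theorem infoGain_det_pos {k : X → X → ℝ} {C : X → J → ℝ} (hk : ∀ x y, k x y = C x ⬝ᵥ C y)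
    {σ : ℝ} (z : ι → X) :
    0 < (1 + (σ ^ 2)⁻¹ • gram k z).det := by
  refine (PosDef.add_posSemidef PosDef.one (PosSemidef.smul ?_ (by positivity))).det_pos
  refine gram_posSemidef (φ := fun x => WithLp.toLp 2 (C x)) (fun x y => ?_) z
  rw [hk, EuclideanSpace.inner_toLp_toLp, star_trivial, dotProduct_comm]

/-- The Gaussian mixture of the likelihood ratios. -/
theorem lintegral_mixture {k : X → X → ℝ} {C : X → J → ℝ} (hk : ∀ x y, k x y = C x ⬝ᵥ C y)
    {σ : ℝ} (hσ : 0 < σ) (z : ι → X) (η : ι → ℝ) :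
    ∫⁻ w : J → ℝ, ENNReal.ofReal
        (Real.exp (-(w ⬝ᵥ w) / 2 + ∑ s, logLik σ (C (z s)) w (η s))) =
      ENNReal.ofReal (Real.exp (noiseEnergy k σ z η / (2 * σ ^ 2) - infoGain k σ z)) *
        gaussianMass J := by
  classical
  set Φ : Matrix ι J ℝ := Matrix.of fun s => C (z s) with hΦ
  have hg : gram k z = Φ * Φᵀ := by
    ext s t
    simp [gram, hk, hΦ, mul_apply, dotProduct]
  have hk' : ∀ x y, k x y =
      inner ℝ (WithLp.toLp 2 (C x) : EuclideanSpace ℝ J) (WithLp.toLp 2 (C y)) := fun x y => by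
    rw [hk, EuclideanSpace.inner_toLp_toLp, star_trivial, dotProduct_comm]
  set P : Matrix J J ℝ := 1 + (σ ^ 2)⁻¹ • (Φᵀ * Φ) with hPdef
  have hP : P.PosDef := PosDef.add_posSemidef PosDef.one
    (PosSemidef.smul (by simpa using posSemidef_conjTranspose_mul_self Φ) (by positivity))
  have hdet : P.det = (1 + (σ ^ 2)⁻¹ • gram k z).det := by
    rw [hPdef, hg, ← Matrix.smul_mul, det_one_add_mul_comm, Matrix.mul_smul]
  set u := (regGram k σ z)⁻¹ *ᵥ η with hu
  have hreg : gram k z *ᵥ u + σ ^ 2 • u = η := by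
    rw [← regGram_mulVec, hu, regGram_mulVec_inv hk' hσ.ne']
  -- Push-through identity: it exhibits the center `Φᵀ u` of the Gaussian integrand in terms of the
  -- regularized Gram matrix.
  have hPx : P *ᵥ (Φᵀ *ᵥ u) = (σ ^ 2)⁻¹ • Φᵀ *ᵥ η := by
    conv_rhs => rw [← hreg]
    rw [hPdef, hg, add_mulVec, one_mulVec, smul_mulVec, mulVec_add, mulVec_smul, smul_add,
      smul_smul, inv_mul_cancel₀ (by positivity), one_smul, add_comm]
    simp only [mulVec_mulVec, Matrix.mul_assoc]
  have hxPx : (Φᵀ *ᵥ u) ⬝ᵥ P *ᵥ (Φᵀ *ᵥ u) = noiseEnergy k σ z η / σ ^ 2 := by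
    rw [hPx, dotProduct_smul, noiseEnergy, ← hu, hg, ← mulVec_mulVec, dotProduct_mulVec η,
      ← mulVec_transpose Φ η, dotProduct_comm, smul_eq_mul]
    field_simp
  have key := lintegral_exp_quadratic hP (Φᵀ *ᵥ u)
  have hs : (√P.det)⁻¹ = Real.exp (-infoGain k σ z) := by
    have h0 := infoGain_det_pos hk (σ := σ) z
    rw [infoGain, hdet, Real.exp_neg, ← Real.exp_log (Real.sqrt_pos.2 h0), Real.log_sqrt h0.le]
    ring_nf
  rw [hs, ← Real.exp_add, hxPx] at key
  convert key using 4 with w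
  · have e1 : ∑ s, logLik σ (C (z s)) w (η s) =
        (σ ^ 2)⁻¹ * ((Φ *ᵥ w) ⬝ᵥ η) - (σ ^ 2)⁻¹ / 2 * ((Φ *ᵥ w) ⬝ᵥ (Φ *ᵥ w)) := by
      simp only [logLik, dotProduct, Finset.sum_sub_distrib, Finset.mul_sum]
      congr 1
      · refine Finset.sum_congr rfl fun s _ => ?_
        simp only [mulVec, hΦ, dotProduct, of_apply]
        ring
      · refine Finset.sum_congr rfl fun s _ => ?_
        simp only [mulVec, hΦ, dotProduct, of_apply]
        field_simp
    rw [e1, hPx, hPdef, add_mulVec, one_mulVec, smul_mulVec, dotProduct_add, dotProduct_smul,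
      smul_dotProduct, ← mulVec_mulVec, dotProduct_mulVec w Φᵀ, vecMul_transpose,
      mulVec_transpose, ← dotProduct_mulVec, dotProduct_comm η, smul_eq_mul, smul_eq_mul]
    ring_nf
  · field_simp
    ring

end Gaussian

/-! ### A maximal inequality and the mixture process -/

section Martingale

open Matrix

variable {Ω : Type*} {mΩ : MeasurableSpace Ω} {P : Measure Ω}

/-- **Ville's inequality** for nonnegative supermartingales. -/
theorem mul_measure_exists_le_lintegral (ℱ : Filtration ℕ mΩ) {M : ℕ → Ω → ℝ≥0∞}
    (hM : ∀ n, Measurable[ℱ n] (M n))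
    (hstep : ∀ n (D : Set Ω), MeasurableSet[ℱ n] D →
      ∫⁻ ω in D, M (n + 1) ω ∂P ≤ ∫⁻ ω in D, M n ω ∂P) (c : ℝ≥0∞) :
    c * P {ω | ∃ n, c ≤ M n ω} ≤ ∫⁻ ω, M 0 ω ∂P := by
  set U : ℕ → Set Ω := fun N => {ω | ∃ n ≤ N, c ≤ M n ω} with hU
  have hge : ∀ n, MeasurableSet[ℱ n] {ω | c ≤ M n ω} := fun n =>
    hM n measurableSet_Ici
  have hUsucc : ∀ N, U (N + 1) = U N ∪ {ω | c ≤ M (N + 1) ω} := fun N => by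
    ext ω
    simp only [hU, Set.mem_ofPred_eq, Set.mem_union, Nat.le_succ_iff]
    constructor
    · rintro ⟨n, h | rfl, h'⟩
      · exact Or.inl ⟨n, h, h'⟩
      · exact Or.inr h'
    · rintro (⟨n, h, h'⟩ | h')
      · exact ⟨n, Or.inl h, h'⟩
      · exact ⟨_, Or.inr rfl, h'⟩
  have hU0 : U 0 = {ω | c ≤ M 0 ω} := by
    ext ω
    simp [hU]
  have hUm : ∀ N, MeasurableSet[ℱ N] (U N) := fun N => by
    induction N with
    | zero => rw [hU0]; exact hge 0
    | succ N ih => rw [hUsucc]; exact (ℱ.mono N.le_succ _ ih).union (hge _)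
  have hmarkov : ∀ n (D : Set Ω), c * P (D ∩ {ω | c ≤ M n ω}) ≤
      ∫⁻ ω in D ∩ {ω | c ≤ M n ω}, M n ω ∂P := fun n D => by
    rw [← setLIntegral_const]
    exact setLIntegral_mono ((hM n).mono (ℱ.le n) le_rfl) fun ω hω => hω.2
  -- Optional stopping by hand: paths that have crossed `c` are frozen at value `c`, the others
  -- continue.
  have claim : ∀ N, c * P (U N) + ∫⁻ ω in (U N)ᶜ, M N ω ∂P ≤ ∫⁻ ω, M 0 ω ∂P := fun N => by
    induction N with
    | zero =>
      rw [← lintegral_add_compl (μ := P) (M 0) (ℱ.le 0 _ (hUm 0))]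
      gcongr ?_ + _
      simpa [hU0] using hmarkov 0 Set.univ
    | succ N ih =>
      refine le_trans ?_ ih
      have h1 : (U (N + 1))ᶜ = (U N)ᶜ \ {ω | c ≤ M (N + 1) ω} := by
        rw [hUsucc, Set.compl_union, Set.sdiff_eq]
      have h2 : U (N + 1) = U N ∪ (U N)ᶜ ∩ {ω | c ≤ M (N + 1) ω} := by
        rw [hUsucc]
        ext ω
        simp only [Set.mem_union, Set.mem_inter_iff, Set.mem_compl_iff]
        tauto
      calc _ ≤ c * P (U N) + c * P ((U N)ᶜ ∩ {ω | c ≤ M (N + 1) ω}) +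
            ∫⁻ ω in (U N)ᶜ \ {ω | c ≤ M (N + 1) ω}, M (N + 1) ω ∂P := by
            rw [h1, ← mul_add]
            gcongr
            conv_lhs => rw [h2]
            exact measure_union_le _ _
        _ ≤ c * P (U N) + ∫⁻ ω in (U N)ᶜ, M (N + 1) ω ∂P := by
            rw [add_assoc, ← lintegral_inter_add_sdiff (M (N + 1)) (U N)ᶜ (ℱ.le _ _ (hge (N + 1)))]
            gcongr
            exact hmarkov _ _
        _ ≤ _ := by
            gcongr _ + ?_
            exact hstep N _ (hUm N).compl
  have hUnion : {ω | ∃ n, c ≤ M n ω} = ⋃ N, U N := by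
    ext ω
    simp only [hU, Set.mem_ofPred_eq, Set.mem_iUnion]
    exact ⟨fun ⟨n, h⟩ => ⟨n, n, le_rfl, h⟩, fun ⟨_, n, _, h⟩ => ⟨n, h⟩⟩
  have hmono : Monotone U := monotone_nat_of_le_succ fun N => by
    rw [hUsucc]
    exact Set.subset_union_left
  rw [hUnion, hmono.measure_iUnion, ENNReal.mul_iSup]
  exact iSup_le fun N => le_self_add.trans (claim N)

variable {A J I : Type*} [Fintype A] [Fintype J] [Fintype I]

/-- The unnormalized mixture density of the weights `w`, times the likelihood ratio of the noise in
the iterations `1, …, n`. -/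
def mixtureDensity (σ : ℝ) (C : A × I → J → ℝ) (a : ℕ → A) (y : ℕ → I → ℝ) (n : ℕ) (w : J → ℝ) :
    ℝ≥0∞ :=
  ENNReal.ofReal (Real.exp (-(w ⬝ᵥ w) / 2 +
    ∑ s : Fin n × I, logLik σ (C (a (s.1 + 1), s.2)) w (y (s.1 + 1) s.2)))

omit [Fintype A] in
theorem mixtureDensity_succ (σ : ℝ) (C : A × I → J → ℝ) (a : ℕ → A) (y : ℕ → I → ℝ) (n : ℕ)
    (w : J → ℝ) : mixtureDensity σ C a y (n + 1) w = mixtureDensity σ C a y n w *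
      ENNReal.ofReal (Real.exp (∑ i, logLik σ (C (a (n + 1), i)) w (y (n + 1) i))) := by
  rw [mixtureDensity, mixtureDensity, ← ENNReal.ofReal_mul (Real.exp_pos _).le, ← Real.exp_add,
    Fintype.sum_prod_type, Fintype.sum_prod_type, Fin.sum_univ_castSucc]
  simp [add_assoc]

/-- The σ-algebra on `Ω` is left general because it is needed twice: as `ℱ n` for adaptedness of the
mixture, and as the full one for Tonelli. -/
theorem measurable_mixtureDensity {Ω : Type*} [MeasurableSpace Ω] (σ : ℝ) (C : A × I → J → ℝ)
    (a : ℕ → Ω → A) (y : ℕ → I → Ω → ℝ) (n : ℕ)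
    (ha : ∀ s < n, ∀ b, MeasurableSet {ω | a (s + 1) ω = b})
    (hy : ∀ s < n, ∀ i, Measurable (y (s + 1) i)) :
    Measurable fun p : Ω × (J → ℝ) =>
      mixtureDensity σ C (fun m => a m p.1) (fun m i => y m i p.1) n p.2 := by
  have hC : ∀ s < n, ∀ i j, Measurable fun ω => C (a (s + 1) ω, i) j := fun s hs i j => by
    let _ : MeasurableSpace A := ⊤
    have h1 : Measurable (a (s + 1)) := measurable_to_countable' fun b => ha s hs b
    exact (measurable_from_top (f := fun b => C (b, i) j)).comp h1
  unfold mixtureDensity logLik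
  simp only [dotProduct]
  have h1 : ∀ (s : Fin n × I) (j : J), Measurable fun p : Ω × (J → ℝ) =>
      C (a (s.1 + 1) p.1, s.2) j := fun s j => (hC s.1 s.1.2 s.2 j).comp measurable_fst
  have h2 : ∀ s : Fin n × I, Measurable fun p : Ω × (J → ℝ) => y (s.1 + 1) s.2 p.1 :=
    fun s => (hy s.1 s.1.2 s.2).comp measurable_fst
  refine ENNReal.measurable_ofReal.comp (Real.measurable_exp.comp ?_)
  refine Measurable.add (by fun_prop) (Finset.measurable_sum _ fun s _ => ?_)
  have h3 : Measurable fun p : Ω × (J → ℝ) => ∑ j, C (a (s.1 + 1) p.1, s.2) j * p.2 j :=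
    Finset.measurable_sum _ fun j _ => (h1 s j).mul (by fun_prop)
  exact ((h3.mul (h2 s)).div_const _).sub ((h3.pow_const 2).div_const _)

theorem measurable_mixtureDensity_left {Ω : Type*} [MeasurableSpace Ω] (σ : ℝ) (C : A × I → J → ℝ)
    (a : ℕ → Ω → A) (y : ℕ → I → Ω → ℝ) (n : ℕ)
    (ha : ∀ s < n, ∀ b, MeasurableSet {ω | a (s + 1) ω = b})
    (hy : ∀ s < n, ∀ i, Measurable (y (s + 1) i)) (w : J → ℝ) :
    Measurable fun ω => mixtureDensity σ C (fun m => a m ω) (fun m i => y m i ω) n w := by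
  have h := measurable_mixtureDensity σ C a y n ha hy
  have h2 : Measurable fun ω : Ω => (ω, w) := measurable_prodMk_right
  simpa only [Function.comp_def] using h.comp h2

/-- The likelihood ratio of sub-Gaussian noise has mean at most `1`. -/
theorem lintegral_exp_logLik_le_one [IsProbabilityMeasure P] {σ : ℝ≥0} (hσ : 0 < σ)
    {y : I → Ω → ℝ} (hindep : iIndepFun y P) (hsub : ∀ i, HasSubgaussianMGF (y i) (σ ^ 2) P)
    (c : I → J → ℝ) (w : J → ℝ) :
    ∫⁻ ω, ENNReal.ofReal (Real.exp (∑ i, logLik σ (c i) w (y i ω))) ∂P ≤ 1 := by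
  set d : I → ℝ := fun i => (c i ⬝ᵥ w) / (σ : ℝ) ^ 2 with hd
  have hsum := HasSubgaussianMGF.sum_of_iIndepFun (μ := P) (X := fun i ω => d i * y i ω)
    (hindep.comp (fun i x => d i * x) fun i => measurable_const_mul _) (s := Finset.univ)
    (fun i _ => (hsub i).const_mul (d i))
  have hint := hsum.integrable_exp_mul 1
  have hle : mgf (fun ω => ∑ i, d i * y i ω) P 1 ≤
      Real.exp ((∑ i, d i ^ 2 * (σ : ℝ) ^ 2) * 1 ^ 2 / 2) := by
    convert hsum.mgf_le 1
    rw [NNReal.coe_sum]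
    rfl
  have heq : ∀ ω, Real.exp (∑ i, logLik σ (c i) w (y i ω)) =
      Real.exp (1 * ∑ i, d i * y i ω) * Real.exp (-∑ i, (c i ⬝ᵥ w) ^ 2 / (2 * (σ : ℝ) ^ 2)) := by
    intro ω
    rw [← Real.exp_add, one_mul, ← sub_eq_add_neg, ← Finset.sum_sub_distrib]
    congr 1
    refine Finset.sum_congr rfl fun i _ => ?_
    rw [logLik, hd]
    ring
  simp_rw [heq]
  rw [← ofReal_integral_eq_lintegral_ofReal (hint.mul_const _) (ae_of_all _ fun ω => by positivity),
    integral_mul_const, ← ENNReal.ofReal_one]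
  refine ENNReal.ofReal_le_ofReal ((mul_le_mul_of_nonneg_right hle (Real.exp_pos _).le).trans ?_)
  rw [← Real.exp_add, Real.exp_le_one_iff]
  -- The quadratic correction in `logLik` is exactly the sub-Gaussian exponent at the coefficients
  -- `d i`.
  refine le_of_eq ?_
  have hσ' : (σ : ℝ) ≠ 0 := by exact_mod_cast hσ.ne'
  rw [one_pow, mul_one, Finset.sum_div, ← sub_eq_add_neg, ← Finset.sum_sub_distrib]
  refine Finset.sum_eq_zero fun i _ => ?_
  simp only [hd]
  field_simp
  simp

/-- The supermartingale property for fixed weights. The next query is known at time `n` and takes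
finitely many values; once it is fixed, the new factor depends only on the fresh noise, which is
independent of `ℱ n`. -/
theorem setLIntegral_mixtureDensity_succ_le [IsProbabilityMeasure P] {σ : ℝ≥0} (hσ : 0 < σ)
    (ℱ : Filtration ℕ mΩ) (y : ℕ → I → Ω → ℝ)
    (hmeas : ∀ n i, Measurable[ℱ (n + 1)] (y (n + 1) i))
    (hpast : ∀ n, Indep (⨆ i, MeasurableSpace.comap (y (n + 1) i) inferInstance) (ℱ n) P)
    (hindep : ∀ n, iIndepFun (y (n + 1)) P)
    (hsub : ∀ n i, HasSubgaussianMGF (y (n + 1) i) (σ ^ 2) P)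
    (a : ℕ → Ω → A) (ha : ∀ n b, MeasurableSet[ℱ n] {ω | a (n + 1) ω = b})
    (C : A × I → J → ℝ) (w : J → ℝ) (n : ℕ) {D : Set Ω} (hD : MeasurableSet[ℱ n] D) :
    ∫⁻ ω in D, mixtureDensity σ C (fun m => a m ω) (fun m i => y m i ω) (n + 1) w ∂P ≤
      ∫⁻ ω in D, mixtureDensity σ C (fun m => a m ω) (fun m i => y m i ω) n w ∂P := by
  classical
  set M : ℕ → Ω → ℝ≥0∞ := fun n ω =>
    mixtureDensity σ C (fun m => a m ω) (fun m i => y m i ω) n w with hMdef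
  have hM : Measurable[ℱ n] (M n) :=
    @measurable_mixtureDensity_left A J I _ _ _ Ω (ℱ n) σ C a y n
      (fun s hs b => ℱ.mono hs.le _ (ha s b))
      (fun s hs i => (hmeas s i).mono (ℱ.mono hs) le_rfl) w
  set T : A → Set Ω := fun b => D ∩ {ω | a (n + 1) ω = b} with hT
  have hTm : ∀ b, MeasurableSet[ℱ n] (T b) := fun b => hD.inter (ha n b)
  have hdecomp : ∀ f : Ω → ℝ≥0∞, ∫⁻ ω in D, f ω ∂P = ∑ b, ∫⁻ ω in T b, f ω ∂P := fun f => by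
    have hDU : D = ⋃ b, T b := by
      ext ω
      simp [hT]
    conv_lhs => rw [hDU]
    rw [lintegral_iUnion (fun b => ℱ.le n _ (hTm b)) (fun b b' hb => ?_), tsum_fintype]
    exact Set.disjoint_left.2 fun ω h h' => hb (h.2.symm.trans h'.2)
  change ∫⁻ ω in D, M (n + 1) ω ∂P ≤ ∫⁻ ω in D, M n ω ∂P
  rw [hdecomp, hdecomp]
  refine Finset.sum_le_sum fun b _ => ?_
  set g : Ω → ℝ≥0∞ := fun ω =>
    ENNReal.ofReal (Real.exp (∑ i, logLik σ (C (b, i)) w (y (n + 1) i ω))) with hg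
  have hgm : Measurable[⨆ i, MeasurableSpace.comap (y (n + 1) i) inferInstance] g := by
    refine ENNReal.measurable_ofReal.comp (Real.measurable_exp.comp ?_)
    refine Finset.measurable_sum _ fun i _ => ?_
    have h1 : Measurable[⨆ i, MeasurableSpace.comap (y (n + 1) i) inferInstance] (y (n + 1) i) :=
      (comap_measurable (y (n + 1) i)).mono
        (le_iSup (fun i => MeasurableSpace.comap (y (n + 1) i) inferInstance) i) le_rfl
    have h2 : Measurable fun t : ℝ => logLik σ (C (b, i)) w t := by
      unfold logLik
      fun_prop
    exact h2.comp h1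
  have hsup : (⨆ i, MeasurableSpace.comap (y (n + 1) i) inferInstance) ≤ mΩ :=
    iSup_le fun i => ((hmeas n i).mono (ℱ.le _) le_rfl).comap_le
  calc ∫⁻ ω in T b, M (n + 1) ω ∂P = ∫⁻ ω in T b, M n ω * g ω ∂P := by
        refine setLIntegral_congr_fun (ℱ.le n _ (hTm b)) fun ω hω => ?_
        have hb : a (n + 1) ω = b := hω.2
        simp only [hMdef, hg, mixtureDensity_succ, hb]
    _ = ∫⁻ ω, (T b).indicator (M n) ω * g ω ∂P := by
        rw [← lintegral_indicator (ℱ.le n _ (hTm b))]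
        refine lintegral_congr fun ω => ?_
        by_cases h : ω ∈ T b <;> simp [h]
    _ = (∫⁻ ω, (T b).indicator (M n) ω ∂P) * ∫⁻ ω, g ω ∂P :=
        lintegral_mul_eq_lintegral_mul_lintegral_of_independent_measurableSpace (ℱ.le n) hsup
          (hpast n).symm (hM.indicator (hTm b)) hgm
    _ ≤ (∫⁻ ω, (T b).indicator (M n) ω ∂P) * 1 := by
        gcongr
        exact lintegral_exp_logLik_le_one hσ (hindep n) (hsub n) _ w
    _ = _ := by rw [mul_one, lintegral_indicator (ℱ.le n _ (hTm b))]

/-- The self-normalized concentration inequality for the noise in kernel regression. -/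
theorem measure_noiseEnergy_ge_le [DecidableEq I] [IsProbabilityMeasure P] {σ : ℝ≥0} (hσ : 0 < σ)
    (ℱ : Filtration ℕ mΩ) (y : ℕ → I → Ω → ℝ)
    (hmeas : ∀ n i, Measurable[ℱ (n + 1)] (y (n + 1) i))
    (hpast : ∀ n, Indep (⨆ i, MeasurableSpace.comap (y (n + 1) i) inferInstance) (ℱ n) P)
    (hindep : ∀ n, iIndepFun (y (n + 1)) P)
    (hsub : ∀ n i, HasSubgaussianMGF (y (n + 1) i) (σ ^ 2) P)
    (a : ℕ → Ω → A) (ha : ∀ n b, MeasurableSet[ℱ n] {ω | a (n + 1) ω = b})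
    {k : A × I → A × I → ℝ} {C : A × I → J → ℝ} (hk : ∀ x x', k x x' = C x ⬝ᵥ C x')
    {δ : ℝ} (hδ : 0 < δ) :
    P {ω | ∃ n : ℕ, infoGain k σ (fun s : Fin n × I => (a (s.1 + 1) ω, s.2)) + Real.log (1 / δ) ≤
      noiseEnergy k σ (fun s : Fin n × I => (a (s.1 + 1) ω, s.2)) (fun s => y (s.1 + 1) s.2 ω) /
        (2 * (σ : ℝ) ^ 2)} ≤ ENNReal.ofReal δ := by
  set M : ℕ → Ω → ℝ≥0∞ := fun n ω => ∫⁻ w : J → ℝ,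
    mixtureDensity σ C (fun m => a m ω) (fun m i => y m i ω) n w with hMdef
  have hJ : ∀ n, Measurable[(ℱ n).prod MeasurableSpace.pi] fun p : Ω × (J → ℝ) =>
      mixtureDensity σ C (fun m => a m p.1) (fun m i => y m i p.1) n p.2 := fun n =>
    @measurable_mixtureDensity A J I _ _ _ Ω (ℱ n) σ C a y n
      (fun s hs b => ℱ.mono hs.le _ (ha s b)) (fun s hs i => (hmeas s i).mono (ℱ.mono hs) le_rfl)
  have hJ' : ∀ n, Measurable fun p : Ω × (J → ℝ) =>
      mixtureDensity σ C (fun m => a m p.1) (fun m i => y m i p.1) n p.2 := fun n =>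
    measurable_mixtureDensity σ C a y n
      (fun s _ b => ℱ.le _ _ (ha s b)) (fun s _ i => (hmeas s i).mono (ℱ.le _) le_rfl)
  have hV := mul_measure_exists_le_lintegral (P := P) ℱ (M := M)
    (fun n => @Measurable.lintegral_prod_right' Ω (J → ℝ) (ℱ n) _ _ _ _ (hJ n))
    (fun n D hD => by
      have hswap : ∀ n, ∫⁻ ω in D, M n ω ∂P = ∫⁻ w : J → ℝ, ∫⁻ ω in D,
          mixtureDensity σ C (fun m => a m ω) (fun m i => y m i ω) n w ∂P := fun n =>
        lintegral_lintegral_swap (f := fun ω w =>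
          mixtureDensity σ C (fun m => a m ω) (fun m i => y m i ω) n w) (hJ' n).aemeasurable
      rw [hswap, hswap]
      exact lintegral_mono fun w =>
        setLIntegral_mixtureDensity_succ_le hσ ℱ y hmeas hpast hindep hsub a ha C w n hD)
    -- The mixture starts at `gaussianMass J`, so this threshold is `1 / δ` times the initial value.
    (ENNReal.ofReal (1 / δ) * gaussianMass J)
  have hM0 : ∫⁻ ω, M 0 ω ∂P = gaussianMass J := by
    simp [hMdef, mixtureDensity, gaussianMass]
  have hMn : ∀ n ω, M n ω = ENNReal.ofReal (Real.exp (noiseEnergy k σ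
      (fun s : Fin n × I => (a (s.1 + 1) ω, s.2)) (fun s => y (s.1 + 1) s.2 ω) / (2 * (σ : ℝ) ^ 2) -
      infoGain k σ (fun s : Fin n × I => (a (s.1 + 1) ω, s.2)))) * gaussianMass J := fun n ω =>
    lintegral_mixture hk (by exact_mod_cast hσ) _ _
  rw [hM0, mul_right_comm] at hV
  have h1 : ENNReal.ofReal (1 / δ) *
      P {ω | ∃ n, ENNReal.ofReal (1 / δ) * gaussianMass J ≤ M n ω} ≤ 1 := by
    by_contra hcon
    rw [not_le] at hcon
    refine absurd hV (not_le.2 ?_)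
    calc gaussianMass J = 1 * gaussianMass J := (one_mul _).symm
      _ < _ := ENNReal.mul_lt_mul_left gaussianMass_ne_zero gaussianMass_ne_top hcon
  have h2 : P {ω | ∃ n, ENNReal.ofReal (1 / δ) * gaussianMass J ≤ M n ω} ≤ ENNReal.ofReal δ := by
    rw [one_div, ENNReal.ofReal_inv_of_pos hδ] at h1 ⊢
    rw [mul_comm, ← div_eq_mul_inv,
      ENNReal.div_le_iff (by simpa using hδ) ENNReal.ofReal_ne_top, one_mul] at h1
    exact h1
  refine (measure_mono ?_).trans h2
  rintro ω ⟨n, hn⟩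
  refine ⟨n, ?_⟩
  rw [hMn]
  gcongr
  rw [← Real.exp_log (show (0 : ℝ) < 1 / δ by positivity)]
  exact Real.exp_le_exp.2 (by linarith)

end Martingale

/-! ### Safe exploration with valid confidence intervals -/

namespace Run

variable {A : Type*} {q : ℕ} (r : Run A q)

theorem monotone_lower (a : A) (i : Fin (q + 1)) : Monotone fun n => r.lower n a i :=
  monotone_nat_of_le_succ fun n => by
    rw [lower]
    exact le_max_left _ _

theorem lower_le_of_abs_le {f : A → Fin (q + 1) → ℝ} (hseed : ∀ a ∈ r.seed, ∀ i ≠ 0, 0 ≤ f a i)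
    (hconf : ∀ n a i, |f a i - r.mean n a i| ≤ r.sqrtB (n + 1) * r.sd n a i) (n : ℕ) (a : A)
    (i : Fin (q + 1)) : r.lower n a i ≤ f a i := by
  induction n with
  | zero =>
    rw [lower]
    split_ifs with h
    · exact_mod_cast hseed a h.1 i h.2
    · exact bot_le
  | succ n ih =>
    rw [lower]
    refine max_le ih (EReal.coe_le_coe_iff.2 ?_)
    linarith [(abs_le.1 (hconf n a i)).1]

theorem le_upper_of_abs_le {f : A → Fin (q + 1) → ℝ}
    (hconf : ∀ n a i, |f a i - r.mean n a i| ≤ r.sqrtB (n + 1) * r.sd n a i) (n : ℕ) (a : A)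
    (i : Fin (q + 1)) : f a i ≤ r.upper n a i := by
  induction n with
  | zero => exact le_top
  | succ n ih =>
    rw [upper]
    refine le_min ih (EReal.coe_le_coe_iff.2 ?_)
    linarith [(abs_le.1 (hconf n a i)).2]

/-- A width below a real number forces the lower bound to be different from `⊥`, after which this is
real arithmetic. -/
theorem sub_le_lower_of_width_lt {f ε : ℝ} {n : ℕ} {a : A} {i : Fin (q + 1)}
    (hl : r.lower n a i ≤ f) (hu : f ≤ r.upper n a i) (hw : r.width n a i < ε) :
    ((f - ε : ℝ) : EReal) ≤ r.lower n a i := by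
  rw [width] at hw
  generalize r.lower n a i = l at *
  generalize r.upper n a i = u at *
  induction l with
  | top => exact le_top
  | bot =>
    rw [EReal.sub_bot (ne_bot_of_le_ne_bot (EReal.coe_ne_bot f) hu)] at hw
    exact absurd hw not_top_lt
  | coe l =>
    induction u with
    | top => exact absurd hw (by simp)
    | bot => exact absurd hu (by simp)
    | coe u =>
      norm_cast at *
      linarith

theorem width_succ_le (n : ℕ) (a : A) (i : Fin (q + 1)) :
    r.width (n + 1) a i ≤ ((2 * (r.sqrtB (n + 1) * r.sd n a i) : ℝ) : EReal) := by
  rw [width, upper, lower]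
  refine (EReal.sub_le_sub (min_le_right _ _) (le_max_right _ _)).trans ?_
  rw [← EReal.coe_sub, EReal.coe_le_coe_iff]
  linarith

variable [PseudoMetricSpace A]

/-- Seed points certify themselves, since their constraint lower bounds start at `0`; later
certificates persist because lower bounds only increase. -/
theorem monotone_safeSet : Monotone r.safeSet := by
  refine monotone_nat_of_le_succ fun n => ?_
  induction n with
  | zero =>
    intro a ha
    simp only [safeSet, Set.mem_iInter, Set.mem_iUnion]
    refine fun i => ⟨a, ha, ?_⟩
    have h0 : r.lower 0 a i.succ = 0 := by
      rw [lower, if_pos ⟨ha, Fin.succ_ne_zero i⟩]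
    have h1 := r.monotone_lower a i.succ (Nat.zero_le 1)
    simp only [h0] at h1
    simpa using h1
  | succ n ih =>
    intro a ha
    rw [safeSet] at ha ⊢
    simp only [Set.mem_iInter, Set.mem_iUnion] at ha ⊢
    intro i
    obtain ⟨a', ha', h⟩ := ha i
    exact ⟨a', ih ha', h.trans (EReal.sub_le_sub (r.monotone_lower a' i.succ (Nat.le_succ _)) le_rfl)⟩

theorem exists_stops_of_stopTime_le {ε : ℝ} {n : ℕ} (h : r.stopTime ε ≤ n) :
    ∃ m ≤ n, r.Stops ε m := by
  have h1 : r.stopTime ε < (n + 1 : ℕ) := h.trans_lt (by exact_mod_cast n.lt_succ_self)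
  simp only [stopTime, iInf_lt_iff] at h1
  obtain ⟨m, hm, hlt⟩ := h1
  exact ⟨m, Nat.lt_succ_iff.1 (by exact_mod_cast hlt), hm⟩

variable {r} {f : A → Fin (q + 1) → ℝ} {ε : ℝ}

theorem Stops.reach_subset {m : ℕ} (hm : r.Stops ε m) (hε : 0 ≤ ε)
    (hl : ∀ n a i, (r.lower n a i : EReal) ≤ f a i) (hu : ∀ n a i, (f a i : EReal) ≤ r.upper n a i) :
    reach (fun b (i : Fin q) => f b i.succ) r.L ε (r.safeSet m) ⊆ r.safeSet m := by
  obtain ⟨h1, hw, hS⟩ := hm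
  obtain ⟨m, rfl⟩ : ∃ m', m = m' + 1 := ⟨m - 1, by omega⟩
  rw [Nat.add_sub_cancel] at hw hS
  rintro a (ha | ⟨a', ha', h⟩)
  · exact ha
  by_contra hcon
  rw [← hS] at ha'
  have hcon' : a ∉ r.safeSet m := hS ▸ hcon
  refine hcon ?_
  rw [safeSet]
  simp only [Set.mem_iInter, Set.mem_iUnion]
  refine fun i => ⟨a', ha', ?_⟩
  -- The excluded point `a` itself shows that its witness `a'` is an expander.
  have hexp : a' ∈ r.expanders m := by
    refine ⟨ha', a, hcon', i, ?_⟩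
    refine le_trans ?_ (EReal.sub_le_sub (hu m a' i.succ) le_rfl)
    rw [← EReal.coe_sub]
    exact EReal.coe_nonneg.2 (by rw [dist_comm]; linarith [h i])
  have h2 := r.sub_le_lower_of_width_lt (hl m a' i.succ) (hu m a' i.succ)
    (hw a' (Or.inl hexp) i.succ)
  change 0 ≤ r.lower (m + 1) a' i.succ - ((r.L * dist a a' : ℝ) : EReal)
  refine le_trans ?_ (EReal.sub_le_sub (h2.trans (r.monotone_lower a' i.succ (Nat.le_succ m))) le_rfl)
  rw [← EReal.coe_sub]
  exact EReal.coe_nonneg.2 (by linarith [h i])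

theorem Stops.reachClosure_subset {m : ℕ} (hm : r.Stops ε m) (hε : 0 ≤ ε)
    (hl : ∀ n a i, (r.lower n a i : EReal) ≤ f a i) (hu : ∀ n a i, (f a i : EReal) ≤ r.upper n a i) :
    reachClosure (fun b (i : Fin q) => f b i.succ) r.L ε r.seed ⊆ r.safeSet m := by
  refine Set.iUnion_subset fun n => ?_
  induction n with
  | zero => exact r.monotone_safeSet (Nat.zero_le m)
  | succ n ih =>
    rw [Function.iterate_succ_apply']
    refine subset_trans ?_ (hm.reach_subset hε hl hu)
    rintro a (ha | ⟨a', ha', h⟩)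
    · exact Or.inl (ih ha)
    · exact Or.inr ⟨a', ih ha', h⟩

theorem Stops.le_of_isBest [Finite A] {m n : ℕ} (hm : r.Stops ε m) (hmn : m ≤ n)
    (hl : ∀ n a i, (r.lower n a i : EReal) ≤ f a i) (hu : ∀ n a i, (f a i : EReal) ≤ r.upper n a i)
    {c b : A} (hc : r.IsBest n c) (hb : b ∈ r.safeSet m) : f b 0 - ε ≤ f c 0 := by
  obtain ⟨h1, hw, hS⟩ := hm
  obtain ⟨m, rfl⟩ : ∃ m', m = m' + 1 := ⟨m - 1, by omega⟩
  rw [Nat.add_sub_cancel] at hw hS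
  rw [← hS] at hb
  -- The true optimum of the safe set is always a maximizer when the intervals are valid.
  obtain ⟨d, hd, hmax⟩ := Set.exists_max_image (r.safeSet m) (fun a => f a 0) (Set.toFinite _) ⟨b, hb⟩
  have hdM : d ∈ r.maximizers m :=
    ⟨hd, iSup₂_le fun a ha => (hl m a 0).trans
      ((EReal.coe_le_coe_iff.2 (hmax a ha)).trans (hu m d 0))⟩
  have h2 := r.sub_le_lower_of_width_lt (hl m d 0) (hu m d 0) (hw d (Or.inr hdM) 0)
  have h3 := hc.2 d (r.monotone_safeSet ((Nat.le_succ m).trans hmn) hd)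
  have h4 := r.monotone_lower d 0 ((Nat.le_succ m).trans hmn)
  have h5 := EReal.coe_le_coe_iff.1 (h2.trans (h4.trans (h3.trans (hl n c 0))))
  linarith [hmax b hb]

/-- Safe exploration with valid confidence intervals covers the reachable region and finds an
`ε`-optimal point of it once it has stopped. -/
theorem subset_safeSet_and_le_of_isBest [Finite A]
    (hseed : ∀ a ∈ r.seed, ∀ i ≠ 0, 0 ≤ f a i)
    (hconf : ∀ n a i, |f a i - r.mean n a i| ≤ r.sqrtB (n + 1) * r.sd n a i) (hε : 0 ≤ ε) {n : ℕ}
    (hn : r.stopTime ε ≤ n) :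
    reachClosure (fun b (i : Fin q) => f b i.succ) r.L ε r.seed ⊆ r.safeSet n ∧
      ∀ c, r.IsBest n c → ∀ b ∈ reachClosure (fun b (i : Fin q) => f b i.succ) r.L ε r.seed,
        f b 0 - ε ≤ f c 0 := by
  obtain ⟨m, hmn, hm⟩ := r.exists_stops_of_stopTime_le hn
  have hl := r.lower_le_of_abs_le hseed hconf
  have hu := r.le_upper_of_abs_le hconf
  have hR := hm.reachClosure_subset hε hl hu
  exact ⟨hR.trans (r.monotone_safeSet hmn), fun c hc b hb => hm.le_of_isBest hmn hl hu hc (hR hb)⟩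

/-! ### Termination -/

/-- The number of evaluations of `b` in the iterations `1, …, n`. -/
def evalCount [DecidableEq A] (r : Run A q) (n : ℕ) (b : A) : ℕ :=
  ((Finset.range n).filter fun s => r.query (s + 1) = b).card

omit [PseudoMetricSpace A] in
theorem evalCount_succ [DecidableEq A] (n : ℕ) (b : A) :
    r.evalCount (n + 1) b = r.evalCount n b + if r.query (n + 1) = b then 1 else 0 := by
  rw [evalCount, evalCount, Finset.range_add_one, Finset.filter_insert]
  split_ifs with h
  · rw [Finset.card_insert_of_notMem (by simp)]
  · simp

omit [PseudoMetricSpace A] in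
theorem sum_evalCount [DecidableEq A] [Fintype A] (n : ℕ) : ∑ b, r.evalCount n b = n := by
  unfold evalCount
  rw [← Finset.card_eq_sum_card_fiberwise (fun _ _ => Finset.mem_coe.2 (Finset.mem_univ _)), Finset.card_range]

omit [PseudoMetricSpace A] in
/-- Infinitely often, the evaluated parameter has been evaluated with positive frequency. -/
theorem exists_lt_evalCount [DecidableEq A] [Fintype A] (n₁ : ℕ) :
    ∃ n ≥ n₁, ((n + 1 : ℕ) : ℝ) / (2 * Fintype.card A) < r.evalCount n (r.query (n + 1)) := by
  by_contra! hcon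
  have hA : 0 < Fintype.card A := Fintype.card_pos_iff.2 ⟨r.query 0⟩
  have hA' : (0 : ℝ) < Fintype.card A := by exact_mod_cast hA
  -- Under `hcon`, a point evaluated after `n₁` had a small count just before. Summing this bound
  -- over `A` gives `N ≤ |A| (n₁ + 1) + N / 2`, false for large `N`.
  have hle : ∀ (N : ℕ) (b : A),
      (r.evalCount N b : ℝ) ≤ n₁ + 1 + (N : ℝ) / (2 * Fintype.card A) := by
    intro N b
    induction N with
    | zero =>
      simp only [evalCount, Finset.range_zero, Finset.filter_empty, Finset.card_empty, Nat.cast_zero]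
      positivity
    | succ N ih =>
      have hmono : (N : ℝ) / (2 * Fintype.card A) ≤ ((N + 1 : ℕ) : ℝ) / (2 * Fintype.card A) := by
        gcongr
        omega
      rw [evalCount_succ]
      split_ifs with h
      · by_cases hN : n₁ ≤ N
        · have := hcon N hN
          rw [h] at this
          push_cast at this ⊢
          have h0 : (0 : ℝ) ≤ n₁ := n₁.cast_nonneg
          linarith
        · have h1 : r.evalCount N b ≤ N := by
            simpa [evalCount] using
              Finset.card_filter_le (Finset.range N) fun s => r.query (s + 1) = b
          have h2 : ((r.evalCount N b + 1 : ℕ) : ℝ) ≤ n₁ := by exact_mod_cast (by omega)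
          have h3 : 0 ≤ ((N + 1 : ℕ) : ℝ) / (2 * Fintype.card A) := by positivity
          linarith
      · rw [add_zero]
        linarith
  obtain ⟨N, hN⟩ := exists_nat_gt (2 * (Fintype.card A * ((n₁ : ℝ) + 1)))
  have h1 : (N : ℝ) ≤ ∑ _b : A, ((n₁ : ℝ) + 1 + (N : ℝ) / (2 * Fintype.card A)) := by
    conv_lhs => rw [← r.sum_evalCount N]
    push_cast
    exact Finset.sum_le_sum fun b _ => hle N b
  rw [Finset.sum_const, Finset.card_univ, nsmul_eq_mul, mul_add] at h1
  have h2 : (Fintype.card A : ℝ) * ((N : ℝ) / (2 * Fintype.card A)) = N / 2 := by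
    field_simp
  linarith

omit [PseudoMetricSpace A] in
theorem sd_le [DecidableEq A] {F : Type*} [NormedAddCommGroup F] [InnerProductSpace ℝ F]
    {φ : A × Fin (q + 1) → F} (hk : ∀ x y, r.k x y = inner ℝ (φ x) (φ y)) (hσ : 0 < r.σ) (n : ℕ)
    (a : A) (i : Fin (q + 1)) (hpos : 0 < r.evalCount n a) :
    r.sd n a i ≤ r.σ / √(r.evalCount n a) := by
  set T : Finset (Fin n × Fin (q + 1)) :=
    Finset.univ.filter fun s => r.query (s.1 + 1) = a ∧ s.2 = i with hT
  have hcard : T.card = r.evalCount n a := by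
    refine Finset.card_bij (fun s _ => (s.1 : ℕ)) ?_ ?_ ?_
    · intro s hs
      simp only [hT, Finset.mem_filter, Finset.mem_univ, true_and] at hs
      simp [hs.1]
    · intro s hs t ht hst
      simp only [hT, Finset.mem_filter, Finset.mem_univ, true_and] at hs ht
      exact Prod.ext (Fin.ext hst) (hs.2.trans ht.2.symm)
    · intro s hs
      simp only [Finset.mem_filter, Finset.mem_range] at hs
      exact ⟨(⟨s, hs.1⟩, i), by simp [hT, hs.2], rfl⟩
  have h := postVar_le_div_card hk hσ.ne' (r.points n) (a, i) T
    (fun s hs => by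
      simp only [hT, Finset.mem_filter, Finset.mem_univ, true_and] at hs
      exact Prod.ext hs.1 hs.2)
    (Finset.card_pos.1 (hcard ▸ hpos))
  rw [sd, ← Real.sqrt_sq hσ.le, ← Real.sqrt_div (sq_nonneg _), ← hcard, Real.sqrt_sq hσ.le]
  exact Real.sqrt_le_sqrt h

/-- Local safe exploration stops. -/
theorem IsLSE.exists_stops [Finite A] (hr : r.IsLSE) {F : Type*} [NormedAddCommGroup F]
    [InnerProductSpace ℝ F] {φ : A × Fin (q + 1) → F} (hk : ∀ x y, r.k x y = inner ℝ (φ x) (φ y))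
    (hσ : 0 < r.σ) (hB : ∀ n, 0 ≤ r.sqrtB n)
    (hBo : (fun n => r.sqrtB n ^ 2) =o[atTop] fun n : ℕ => (n : ℝ)) (hε : 0 < ε) :
    ∃ n, r.Stops ε n := by
  classical
  have := Fintype.ofFinite A
  by_contra! hcon
  obtain ⟨n₀, hn₀⟩ := WellFoundedGT.monotone_chain_condition ⟨r.safeSet, r.monotone_safeSet⟩
  have hA : (0 : ℝ) < Fintype.card A := by exact_mod_cast Fintype.card_pos_iff.2 ⟨r.query 0⟩
  -- Chosen so that a width of at least `ε` forces a count of at most `(n + 1) / (4 |A|)`, half the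
  -- pigeonhole bound.
  set c : ℝ := ε ^ 2 / (4 * r.σ ^ 2) / (4 * Fintype.card A) with hc
  have hcpos : 0 < c := by positivity
  obtain ⟨n₁, hn₁⟩ := eventually_atTop.1 (hBo.bound hcpos)
  obtain ⟨n, hn, hcount⟩ := r.exists_lt_evalCount (max n₀ n₁)
  have hSeq : r.safeSet (n + 1 + 1 - 1) = r.safeSet (n + 1 + 1) := by
    rw [Nat.add_sub_cancel]
    exact (hn₀ (n + 1) (by omega)).symm.trans (hn₀ (n + 1 + 1) (by omega))
  have hns := hcon (n + 1 + 1)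
  have hex : ∃ a ∈ r.expanders (n + 1) ∪ r.maximizers (n + 1), ∃ i, (ε : EReal) ≤ r.width (n + 1) a i := by
    by_contra! h
    exact hns ⟨by omega, h, hSeq⟩
  obtain ⟨a, ha, i, hi⟩ := hex
  have hmax := (hr (n + 1) (by omega) ⟨a, ha⟩).2 a ha
  have hpos : 0 < r.evalCount n (r.query (n + 1)) := by
    have : (0 : ℝ) < r.evalCount n (r.query (n + 1)) := lt_of_le_of_lt (by positivity) hcount
    exact_mod_cast this
  have hT : (0 : ℝ) < r.evalCount n (r.query (n + 1)) := by exact_mod_cast hpos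
  set T : ℝ := (r.evalCount n (r.query (n + 1)) : ℝ) with hTdef
  have hsup : (⨆ j, r.width (n + 1) (r.query (n + 1)) j) ≤
      ((2 * (r.sqrtB (n + 1) * (r.σ / √T)) : ℝ) : EReal) := by
    refine iSup_le fun j => (r.width_succ_le n _ j).trans (EReal.coe_le_coe_iff.2 ?_)
    have := r.sd_le hk hσ n (r.query (n + 1)) j hpos
    gcongr
    exact hB _
  have hεle : ε ≤ 2 * (r.sqrtB (n + 1) * (r.σ / √T)) :=
    EReal.coe_le_coe_iff.1 (((hi.trans (le_iSup (fun j => r.width (n + 1) a j) i)).trans hmax).trans hsup)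
  have hsq : ε ^ 2 * T ≤ 4 * r.sqrtB (n + 1) ^ 2 * r.σ ^ 2 := by
    have h1 : ε ^ 2 ≤ (2 * (r.sqrtB (n + 1) * (r.σ / √T))) ^ 2 := by gcongr
    have h2 : (2 * (r.sqrtB (n + 1) * (r.σ / √T))) ^ 2 =
        4 * r.sqrtB (n + 1) ^ 2 * r.σ ^ 2 / T := by
      rw [mul_pow, mul_pow, div_pow, Real.sq_sqrt hT.le]
      ring
    rw [h2, le_div_iff₀ hT] at h1
    exact h1
  have hb := hn₁ (n + 1) (by omega)
  rw [Real.norm_of_nonneg (sq_nonneg _), Real.norm_of_nonneg (Nat.cast_nonneg _)] at hb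
  have h3 : ε ^ 2 * T ≤ ε ^ 2 * (((n + 1 : ℕ) : ℝ) / (4 * Fintype.card A)) := by
    refine hsq.trans ?_
    calc 4 * r.sqrtB (n + 1) ^ 2 * r.σ ^ 2 ≤ 4 * (c * ((n + 1 : ℕ) : ℝ)) * r.σ ^ 2 := by gcongr
      _ = _ := by
        rw [hc]
        field_simp
  have h4 : T ≤ ((n + 1 : ℕ) : ℝ) / (4 * Fintype.card A) := le_of_mul_le_mul_left h3 (by positivity)
  have h5 : ((n + 1 : ℕ) : ℝ) / (4 * Fintype.card A) ≤ ((n + 1 : ℕ) : ℝ) / (2 * Fintype.card A) := by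
    gcongr
    norm_num
  linarith

end Run

/-! ### The confidence scaling -/

section Scaling

variable {X ι : Type*} [Fintype ι] [DecidableEq ι] {k : X → X → ℝ} {σ : ℝ}

theorem infoGain_le_maxInfoGain [Finite X] (z : ι → X) :
    infoGain k σ z ≤ maxInfoGain k σ (Fintype.card ι) := by
  have e := Fintype.equivFin ι
  have h : infoGain k σ z = infoGain k σ (z ∘ e.symm) := by
    rw [infoGain, infoGain, ← Matrix.det_submatrix_equiv_self e.symm]
    congr 3
    ext i j
    simp [gram, Matrix.one_apply]
  rw [h]
  exact le_ciSup (f := fun z : Fin (Fintype.card ι) → X => infoGain k σ z)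
    (Set.finite_range _).bddAbove _

theorem sqrtBeta_nonneg {B δ : ℝ} (hB : 0 ≤ B) (m n : ℕ) : 0 ≤ sqrtBeta k σ B δ m n := by
  have : 0 ≤ max (4 * σ) √2 := le_max_of_le_right (Real.sqrt_nonneg _)
  unfold sqrtBeta
  positivity

/-- Combines `(x + y) ^ 2 ≤ 2 x ^ 2 + 2 y ^ 2` with sublinearity of the information gain along `(n -
1) * m`. The absolute value also covers a negative radicand. -/
theorem sqrtBeta_sq_isLittleO {B δ : ℝ} {m : ℕ} (hm : 0 < m)
    (hγ : (fun n : ℕ => maxInfoGain k σ n) =o[atTop] fun n : ℕ => (n : ℝ)) :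
    (fun n => sqrtBeta k σ B δ m n ^ 2) =o[atTop] fun n : ℕ => (n : ℝ) := by
  have hcast : Tendsto (fun n : ℕ => (n : ℝ)) atTop atTop := tendsto_natCast_atTop_atTop
  have hconst : ∀ c : ℝ, (fun _ : ℕ => c) =o[atTop] fun n : ℕ => (n : ℝ) := fun c =>
    Asymptotics.isLittleO_const_left.2 (Or.inr (tendsto_norm_atTop_atTop.comp hcast))
  have hsub : Tendsto (fun n : ℕ => (n - 1) * m) atTop atTop :=
    (tendsto_sub_atTop_nat 1).atTop_mul_const' hm
  have h1 : (fun n : ℕ => maxInfoGain k σ ((n - 1) * m)) =o[atTop] fun n : ℕ => (n : ℝ) := by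
    refine (hγ.comp_tendsto hsub).trans_isBigO (Asymptotics.IsBigO.of_bound m ?_)
    filter_upwards with n
    simp only [Function.comp_apply, Real.norm_natCast]
    rw [mul_comm]
    exact_mod_cast Nat.mul_le_mul_left m (Nat.sub_le n 1)
  have h2 : (fun n : ℕ => 2 * B ^ 2 + 2 * max (4 * σ) √2 ^ 2 *
      |maxInfoGain k σ ((n - 1) * m) + 1 + Real.log (1 / δ)|) =o[atTop] fun n : ℕ => (n : ℝ) :=
    (hconst _).add ((((h1.add (hconst 1)).add (hconst _)).abs_left).const_mul_left _)
  refine Asymptotics.IsBigO.trans_isLittleO (Asymptotics.IsBigO.of_bound 1 ?_) h2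
  filter_upwards with n
  rw [one_mul, Real.norm_of_nonneg (sq_nonneg _), Real.norm_of_nonneg (by positivity), sqrtBeta]
  set g := maxInfoGain k σ ((n - 1) * m) + 1 + Real.log (1 / δ)
  have h3 : √g ^ 2 ≤ |g| := by
    rw [← Real.sq_sqrt (abs_nonneg g)]
    gcongr
    exact le_abs_self g
  have h4 := mul_le_mul_of_nonneg_left h3 (sq_nonneg (max (4 * σ) √2))
  nlinarith [sq_nonneg (B - max (4 * σ) √2 * √g)]

end Scaling

/-- The features of the points in a reproducing kernel Hilbert space. -/
theorem kern_eq_inner {X H : Type*} [NormedAddCommGroup H] [InnerProductSpace ℝ H] [CompleteSpace H]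
    [RKHS ℝ H X ℝ] (x y : X) :
    kern H x y = inner ℝ (RKHS.kerFun H x (1 : ℝ)) (RKHS.kerFun H y (1 : ℝ)) := by
  rw [kern, RKHS.kerFun_inner, RKHS.kerFun_apply]
  simp

theorem inner_kerFun_one {X H : Type*} [NormedAddCommGroup H] [InnerProductSpace ℝ H]
    [CompleteSpace H] [RKHS ℝ H X ℝ] (x : X) (h : H) :
    inner ℝ (RKHS.kerFun H x (1 : ℝ)) h = h x := by
  simp

/-- On a finite set, a kernel has finitely many real features. -/
theorem exists_features {X F : Type*} [Finite X] [NormedAddCommGroup F] [InnerProductSpace ℝ F]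
    {k : X → X → ℝ} {φ : X → F} (hk : ∀ x y, k x y = inner ℝ (φ x) (φ y)) :
    ∃ (m : ℕ) (C : X → Fin m → ℝ), ∀ x y, k x y = C x ⬝ᵥ C y := by
  have := Fintype.ofFinite X
  obtain ⟨m, v, hv⟩ := Matrix.posSemidef_iff_eq_sum_vecMulVec.1 (gram_posSemidef hk (id : X → X))
  refine ⟨m, fun x i => v i x, fun x y => ?_⟩
  have h := congrFun (congrFun hv x) y
  simpa [gram, Matrix.sum_apply, Matrix.vecMulVec_apply, dotProduct] using h

/-- The confidence intervals of the run contain the true values if the noise is not too large. -/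
theorem abs_sub_mean_le {A : Type*} [Finite A] {q : ℕ} {H : Type*} [NormedAddCommGroup H]
    [InnerProductSpace ℝ H] [CompleteSpace H] [RKHS ℝ H (A × Fin (q + 1)) ℝ] {h : H} {σ B δ : ℝ}
    (hB : ‖h‖ ≤ B) (hσ : 0 < σ) {L : ℝ} {S : Set A} {a : ℕ → A} {noise : ℕ → Fin (q + 1) → ℝ} {n : ℕ}
    (hnoise : noiseEnergy (kern H) σ (fun s : Fin n × Fin (q + 1) => (a (s.1 + 1), s.2))
      (fun s => noise (s.1 + 1) s.2) / (2 * σ ^ 2) ≤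
        infoGain (kern H) σ (fun s : Fin n × Fin (q + 1) => (a (s.1 + 1), s.2)) + Real.log (1 / δ))
    (b : A) (i : Fin (q + 1)) :
    |h (b, i) - (mkRun h σ B δ L S a noise).mean n b i| ≤
      (mkRun h σ B δ L S a noise).sqrtB (n + 1) * (mkRun h σ B δ L S a noise).sd n b i := by
  set z : Fin n × Fin (q + 1) → A × Fin (q + 1) := fun s => (a (s.1 + 1), s.2) with hz
  have h1 := abs_sub_postMean_le (kern_eq_inner (H := H)) hσ z
    (fun s => noise (s.1 + 1) s.2) h (b, i)
  simp_rw [inner_kerFun_one] at h1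
  refine h1.trans (mul_le_mul_of_nonneg_right ?_ (Real.sqrt_nonneg _))
  refine add_le_add hB ?_
  have h2 : infoGain (kern H) σ z ≤ maxInfoGain (kern H) σ (n * (q + 1)) := by
    simpa using infoGain_le_maxInfoGain (k := kern H) (σ := σ) z
  have h3 : noiseEnergy (kern H) σ z (fun s => noise (s.1 + 1) s.2) / σ ^ 2 ≤
      2 * (maxInfoGain (kern H) σ (n * (q + 1)) + 1 + Real.log (1 / δ)) := by
    have : noiseEnergy (kern H) σ z (fun s => noise (s.1 + 1) s.2) / σ ^ 2 =
        2 * (noiseEnergy (kern H) σ z (fun s => noise (s.1 + 1) s.2) / (2 * σ ^ 2)) := by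
      field_simp
    rw [this]
    linarith
  refine (Real.sqrt_le_sqrt h3).trans ?_
  -- The entry `√2` of the maximum in `sqrtBeta` suffices; the other entry and the summand `1` are
  -- slack.
  rw [Real.sqrt_mul (by norm_num), Nat.add_sub_cancel]
  exact mul_le_mul_of_nonneg_right (le_max_right _ _) (Real.sqrt_nonneg _)

end SafeExploration

end

/-! ### Termination on every path, and the guarantees off the bad noise event -/

theorem mainTheorem3
    -- finite parameter space, functions `h (a, 0) = f a` and `h (a, i.succ) = g_i a`
    {E : Type*} [NormedAddCommGroup E] [NormedSpace ℝ E] (A : Finset E) (q : ℕ)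
    {H : Type*} [NormedAddCommGroup H] [InnerProductSpace ℝ H] [CompleteSpace H]
    [RKHS ℝ H (A × Fin (q + 1)) ℝ]
    (h : H) (B : ℝ) (hB : ‖h‖ ≤ B)
    (L : ℝ≥0) (hL : ∀ i : Fin (q + 1), LipschitzWith L fun a : A => h (a, i))
    -- safe seed
    (S : Set A) (hSne : S.Nonempty) (hS : ∀ a ∈ S, ∀ i : Fin q, 0 ≤ h (a, i.succ))
    -- independent sub-Gaussian noise; `ℱ n` is the information available after `n` iterations
    {Ω : Type*} [mΩ : MeasurableSpace Ω] (P : Measure Ω) [IsProbabilityMeasure P]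
    (σ : ℝ≥0) (hσ : 0 < σ) (ℱ : Filtration ℕ mΩ) (noise : ℕ → Fin (q + 1) → Ω → ℝ)
    (hnoise_meas : ∀ n i, Measurable[ℱ (n + 1)] (noise (n + 1) i))
    (hnoise_past : ∀ n,
      Indep (⨆ i, MeasurableSpace.comap (noise (n + 1) i) inferInstance) (ℱ n) P)
    (hnoise_indep : ∀ n, iIndepFun (noise (n + 1)) P)
    (hnoise_sub : ∀ n i, HasSubgaussianMGF (noise (n + 1) i) (σ ^ 2) P)
    (ε δ : ℝ) (hε : 0 < ε) (hδ : 0 < δ)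
    -- sublinear growth of the maximum information gain
    (hγ : (fun n : ℕ => SafeExploration.maxInfoGain (SafeExploration.kern H) (σ : ℝ) n)
      =o[atTop] fun n : ℕ => (n : ℝ))
    -- the evaluated parameters: chosen without looking ahead, by the acquisition rule
    (a : ℕ → Ω → A) (ha : ∀ n b, MeasurableSet[ℱ n] {ω | a (n + 1) ω = b})
    (hrun : ∀ ω, (SafeExploration.mkRun h σ B δ L S (fun n => a n ω)
      fun n i => noise n i ω).IsLSE) :
    (∀ ω, (SafeExploration.mkRun h σ B δ L S (fun n => a n ω)
      fun n i => noise n i ω).stopTime ε < ⊤) ∧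
    1 - ENNReal.ofReal δ ≤ P {ω |
      let r := SafeExploration.mkRun h σ B δ L S (fun n => a n ω) fun n i => noise n i ω
      let R := SafeExploration.reachClosure (fun b (i : Fin q) => h (b, i.succ)) L ε S
      ∀ n : ℕ, r.stopTime ε ≤ n →
        R ⊆ r.safeSet n ∧
        ∀ â, r.IsBest n â → ∀ b ∈ R, h (b, 0) - ε ≤ h (â, 0)} := by
  have hσ' : (0 : ℝ) < σ := by exact_mod_cast hσ
  have hB0 : 0 ≤ B := (norm_nonneg h).trans hB
  refine ⟨fun ω => ?_, ?_⟩
  · obtain ⟨n, hn⟩ := (hrun ω).exists_stops SafeExploration.kern_eq_inner hσ'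
      (fun n => SafeExploration.sqrtBeta_nonneg hB0 _ n)
      (SafeExploration.sqrtBeta_sq_isLittleO q.succ_pos hγ) hε
    exact (iInf₂_le n hn).trans_lt (ENat.natCast_lt_top n)
  obtain ⟨m, C, hC⟩ := SafeExploration.exists_features (SafeExploration.kern_eq_inner (H := H))
  have hbad := SafeExploration.measure_noiseEnergy_ge_le hσ ℱ noise hnoise_meas hnoise_past
    hnoise_indep hnoise_sub a ha hC hδ
  refine (tsub_le_tsub_left hbad 1).trans ?_
  -- Covering the whole space by the bad and the good event uses only subadditivity, so the good
  -- event need not be shown measurable.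
  rw [tsub_le_iff_left, ← measure_univ (μ := P)]
  refine (measure_mono fun ω _ => ?_).trans (measure_union_le _ _)
  refine or_iff_not_imp_left.2 fun hω => ?_
  simp only [Set.mem_ofPred_eq, not_exists, not_le] at hω
  exact fun n hn => SafeExploration.Run.subset_safeSet_and_le_of_isBest (f := fun b i => h (b, i))
    (fun b hb i hi => by
      obtain ⟨j, rfl⟩ := Fin.exists_succ_eq.2 hi
      exact hS b hb j)
    (fun n b i => SafeExploration.abs_sub_mean_le hB hσ' (hω n).le b i) hε.le hn
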